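/- Let $\kappa,\rho\in\mathbb R$ and $\omega>0$ be such that $\kappa/\omega$ is an integer, and put $T=2\pi/\omega$. For $\theta\in\mathbb R$ consider the two-level evolution equations $$i\,\psi'(t)=H_{\pm}(t)\,\psi(t),\qquad H_{\pm}(t)=\kappa\sigma_x+h_z^{\pm}(t)\,\sigma_z,\qquad h_z^{\pm}(t)=-i\rho\,e^{i(\pm\omega t+\theta)},\qquad \psi(t)\in\mathbb C^2,$$ where $\sigma_x=\begin{pmatrix}0&1\\1&0\end{pmatrix}$, $\sigma_z=\begin{pmatrix}1&0\\0&-1\end{pmatrix}$, and the sign $+$ (resp. $-$) is the counterclockwise (resp. clockwise) loop with angle $\theta$ at $t=0$. The transfer matrix $S_\pm(t_1,t_0)$ is the matrix with $\psi(t_1)=S_\pm(t_1,t_0)\psi(t_0)$ for every solution $\psi$, every $v\in\mathbb C^2$ being the value $\psi(t_0)$ of some solution. Then, for every $\theta$ and every $t_0\in\mathbb R$, the one-period transfer matrices exist and are exactly the identity: $$S_+(t_0+T,t_0)=S_-(t_0+T,t_0)=I.$$ Consequently, the non-chirality degree is exactly $1$: let $\theta\in\mathbb R$ and let $R_+,R_-$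 be any basis of $\mathbb C^2$ consisting of eigenvectors of $H_+(0)=H_-(0)$. For $\alpha\in\{+,-\}$ write $S_{\pm}(T,0)R_\alpha=p_\pm^\alpha R_++q_\pm^\alpha R_-$ and $$\chi_c^\alpha=\frac{\left|\overline{p_+^\alpha}\,p_-^\alpha+\overline{q_+^\alpha}\,q_-^\alpha\right|^2}{\left(|p_+^\alpha|^2+|q_+^\alpha|^2\right)\left(|p_-^\alpha|^2+|q_-^\alpha|^2\right)},\qquad \chi_c=\tfrac12\left(\chi_c^++\chi_c^-\right).$$ Then $\chi_c=1$. -/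

import Mathlib

open Matrix

/-- The Pauli matrix `σ_x`. -/
def pauliX : Matrix (Fin 2) (Fin 2) ℂ := !![0, 1; 1, 0]

/-- The Pauli matrix `σ_z`. -/
def pauliZ : Matrix (Fin 2) (Fin 2) ℂ := !![1, 0; 0, -1]

/-- The circle `h_z(t) = -i ρ e^{i (ω t + θ)}` centred at the origin, of radius `ρ`, with angular
velocity `ω` (counterclockwise for `ω > 0`, clockwise for `ω < 0`) and with angle `θ` at `t = 0`. -/
noncomputable def loopB (ρ ω θ t : ℝ) : ℂ :=
  -Complex.I * (ρ : ℂ) * Complex.exp (Complex.I * ((ω * t + θ : ℝ) : ℂ))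

/-- The Hamiltonian `H(t) = κ σ_x + h_z(t) σ_z` along the circle `h_z = loopB ρ ω θ`. -/
noncomputable def loopBHamiltonian (κ ρ ω θ t : ℝ) : Matrix (Fin 2) (Fin 2) ℂ :=
  (κ : ℂ) • pauliX + loopB ρ ω θ t • pauliZ

/-- `ψ = (a, b)` solves the evolution equation `i ψ'(t) = H(t) ψ(t)` (units `ħ = 1`). -/
def IsEvolution (H : ℝ → Matrix (Fin 2) (Fin 2) ℂ) (ψ : ℝ → Fin 2 → ℂ) : Prop :=
  ∀ t : ℝ, HasDerivAt ψ (-Complex.I • (H t *ᵥ ψ t)) t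

/-- `S` is the transfer matrix of `i ψ' = H ψ` from time `t₀` to time `t₁`: every vector is the
value at `t₀` of a solution, and every solution satisfies `ψ(t₁) = S ψ(t₀)`. -/
def IsTransferMatrix (H : ℝ → Matrix (Fin 2) (Fin 2) ℂ) (t₁ t₀ : ℝ)
    (S : Matrix (Fin 2) (Fin 2) ℂ) : Prop :=
  (∀ v : Fin 2 → ℂ, ∃ ψ, IsEvolution H ψ ∧ ψ t₀ = v) ∧
    ∀ ψ, IsEvolution H ψ → ψ t₁ = S *ᵥ ψ t₀

theorem IsTransferMatrix.unique {H : ℝ → Matrix (Fin 2) (Fin 2) ℂ} {t₁ t₀ : ℝ}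
    {S S' : Matrix (Fin 2) (Fin 2) ℂ} (h : IsTransferMatrix H t₁ t₀ S)
    (h' : IsTransferMatrix H t₁ t₀ S') : S = S' := by
  apply Matrix.mulVec_injective
  funext v
  obtain ⟨ψ, hψ, rfl⟩ := h.1 v
  rw [← h.2 ψ hψ, ← h'.2 ψ hψ]

open Classical in
/-- The transfer matrix `S(t₁, t₀)` of `i ψ' = H ψ` (it is `0` if there is none). -/
noncomputable def transferMatrix (H : ℝ → Matrix (Fin 2) (Fin 2) ℂ) (t₁ t₀ : ℝ) :
    Matrix (Fin 2) (Fin 2) ℂ :=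
  if h : ∃ S, IsTransferMatrix H t₁ t₀ S then h.choose else 0

theorem IsTransferMatrix.transferMatrix_eq {H : ℝ → Matrix (Fin 2) (Fin 2) ℂ} {t₁ t₀ : ℝ}
    {S : Matrix (Fin 2) (Fin 2) ℂ} (h : IsTransferMatrix H t₁ t₀ S) :
    transferMatrix H t₁ t₀ = S := by
  have hS : ∃ S, IsTransferMatrix H t₁ t₀ S := ⟨S, h⟩
  rw [transferMatrix, dif_pos hS]
  exact hS.choose_spec.unique h

/-- The normalized squared overlap
`|p₁* p₂ + q₁* q₂|² / ((|p₁|² + |q₁|²) (|p₂|² + |q₂|²))` of the coordinate vectors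
`(p₁, q₁)`, `(p₂, q₂)` of `ψ₁`, `ψ₂` in the basis `R`. -/
noncomputable def normalizedOverlap (R : Module.Basis (Fin 2) ℂ (Fin 2 → ℂ))
    (ψ₁ ψ₂ : Fin 2 → ℂ) : ℝ :=
  ‖star (R.repr ψ₁ 0) * R.repr ψ₂ 0 + star (R.repr ψ₁ 1) * R.repr ψ₂ 1‖ ^ 2 /
    ((‖R.repr ψ₁ 0‖ ^ 2 + ‖R.repr ψ₁ 1‖ ^ 2) * (‖R.repr ψ₂ 0‖ ^ 2 + ‖R.repr ψ₂ 1‖ ^ 2))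

/-- `R 0`, `R 1` are adiabatic states (right eigenvectors) `|R_±(0)⟩` of `H`. -/
def IsAdiabaticBasis (H : Matrix (Fin 2) (Fin 2) ℂ)
    (R : Module.Basis (Fin 2) ℂ (Fin 2 → ℂ)) : Prop :=
  ∀ α : Fin 2, ∃ μ : ℂ, H *ᵥ R α = μ • R α

/-- `χ_c^α` for the loop started at angle `θ`: the state `R α` is evolved for one period
`T = 2π/ω` counterclockwise (angular velocity `ω`) and clockwise (angular velocity `-ω`), and the
two final states are compared in the basis `R`. -/
noncomputable def nonChiralityOf (κ ρ ω θ : ℝ) (R : Module.Basis (Fin 2) ℂ (Fin 2 → ℂ))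
    (α : Fin 2) : ℝ :=
  normalizedOverlap R
    (transferMatrix (loopBHamiltonian κ ρ ω θ) (2 * Real.pi / ω) 0 *ᵥ R α)
    (transferMatrix (loopBHamiltonian κ ρ (-ω) θ) (2 * Real.pi / ω) 0 *ᵥ R α)

/-- The non-chirality degree `χ_c = (χ_c^+ + χ_c^-) / 2`. -/
noncomputable def nonChiralityDegree (κ ρ ω θ : ℝ)
    (R : Module.Basis (Fin 2) ℂ (Fin 2 → ℂ)) : ℝ :=
  (nonChiralityOf κ ρ ω θ R 0 + nonChiralityOf κ ρ ω θ R 1) / 2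

/-! With `u = a + b`, `v = a - b`, `z = e^{i(ωt+θ)}`, `n = κ/ω` and `c = -iρ/ω`, the system becomes
`z u_z = -n u - c z v`, `z v_z = n v - c z u`, with a regular singular point at `z = 0` and
exponents `∓n`. The integer difference `2n` could force a logarithm, but the equations couple powers
of opposite parity: in `u = z^{-n} F(z²)`, `v = z^{-n} z G(z²)` the only critical divisors are the
odd integers `2j + 1 - 2n`, never zero. So `F` and `G` are entire.

Exchanging `u` and `v` and replacing `n` by `-n` gives a second solution, independent by
`wronskian_series`. Both are single-valued in `z`, because `n` is an integer, so they return to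
their values after one period, and `isTransferMatrix_one_of_fundamental` yields the identity.
Reversing the loop only replaces `(ω, n)` by `(-ω, -n)`. The two final states then coincide, so each
overlap is `1`. -/

/-- A power series whose coefficients are bounded by `C r ^ j / j!` is entire, and may be
differentiated term by term. -/
theorem hasDerivAt_tsum_of_norm_le_div_factorial {a : ℕ → ℂ} {C r : ℝ}
    (ha : ∀ j, ‖a j‖ ≤ C * (r ^ j / j.factorial)) (y : ℂ) :
    HasDerivAt (fun y => ∑' j, a j * y ^ j) (∑' j : ℕ, (j + 1 : ℂ) * a (j + 1) * y ^ j) y ∧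
      Summable (fun j => a j * y ^ j) ∧
      Summable (fun j : ℕ => (j + 1 : ℂ) * a (j + 1) * y ^ j) := by
  have hsum : ∀ y : ℂ, Summable (fun j => a j * y ^ j) := fun y => by
    refine Summable.of_norm_bounded (g := fun j => C * ((r * ‖y‖) ^ j / j.factorial))
      ((Real.summable_pow_div_factorial _).mul_left C) fun j => ?_
    rw [norm_mul, norm_pow]
    calc ‖a j‖ * ‖y‖ ^ j ≤ C * (r ^ j / j.factorial) * ‖y‖ ^ j := by gcongr; exact ha j
      _ = _ := by rw [mul_pow]; ring
  set R : ℝ := ‖y‖ + 1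
  have hR : 0 < R := by positivity
  have hbound : Summable (fun j : ℕ => (j : ℝ) * ‖a j‖ * R ^ (j - 1)) := by
    rw [← summable_nat_add_iff 1]
    refine Summable.of_nonneg_of_le (fun j => by positivity) (fun j => ?_)
      (((Real.summable_pow_div_factorial (r * R)).mul_left (C * r)))
    have hj : ((j.factorial : ℕ) : ℝ) ≠ 0 := by positivity
    have hj' : ((j : ℝ) + 1) ≠ 0 := by positivity
    calc ((j + 1 : ℕ) : ℝ) * ‖a (j + 1)‖ * R ^ (j + 1 - 1)
        ≤ ((j + 1 : ℕ) : ℝ) * (C * (r ^ (j + 1) / (j + 1).factorial)) * R ^ (j + 1 - 1) := by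
          gcongr; exact ha _
      _ = _ := by
          rw [Nat.factorial_succ, mul_pow, Nat.add_sub_cancel]
          push_cast
          field_simp
          ring
  have hnorm : ∀ j : ℕ, ∀ z ∈ Metric.ball (0 : ℂ) R,
      ‖a j * (j * z ^ (j - 1))‖ ≤ (j : ℝ) * ‖a j‖ * R ^ (j - 1) := fun j z hz => by
    rw [mem_ball_zero_iff] at hz
    rw [norm_mul, norm_mul, norm_pow, Complex.norm_natCast]
    calc ‖a j‖ * (j * ‖z‖ ^ (j - 1)) ≤ ‖a j‖ * (j * R ^ (j - 1)) := by gcongr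
      _ = _ := by ring
  have hy : y ∈ Metric.ball (0 : ℂ) R := by simp [R]
  have hder := hasDerivAt_tsum_of_isPreconnected hbound Metric.isOpen_ball
    (convex_ball (0 : ℂ) R).isPreconnected
    (fun j z _ => (hasDerivAt_pow j z).const_mul (a j)) hnorm hy (hsum y) hy
  have hsum' : Summable (fun j : ℕ => a j * (j * y ^ (j - 1))) :=
    Summable.of_norm_bounded hbound fun j => hnorm j y hy
  refine ⟨?_, hsum y, ?_⟩
  · refine HasDerivAt.congr_deriv (hder) ?_
    rw [hsum'.tsum_eq_zero_add]
    simp only [Nat.cast_zero, zero_mul, mul_zero, zero_add, Nat.add_sub_cancel, Nat.cast_add,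
      Nat.cast_one]
    exact tsum_congr fun j => by ring
  · refine ((summable_nat_add_iff 1).2 hsum').congr fun j => ?_
    simp only [Nat.add_sub_cancel, Nat.cast_add, Nat.cast_one]
    ring

/-! ### Frobenius series at `z = 0` -/

namespace LoopB

/-- The coefficients of the even component of the Frobenius solution. -/
noncomputable def evenCoeff (c : ℂ) (m : ℤ) : ℕ → ℂ
  | 0 => 1
  | j + 1 => c ^ 2 / ((2 * j + 2) * (2 * j + 1 - 2 * m)) * evenCoeff c m j

/-- The coefficients of the odd component of the Frobenius solution. -/
noncomputable def oddCoeff (c : ℂ) (m : ℤ) (j : ℕ) : ℂ :=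
  -c / (2 * j + 1 - 2 * m) * evenCoeff c m j

/-- An exponent difference `2 m` is never met by an odd power. -/
theorem one_le_norm_odd (j : ℕ) (m : ℤ) : 1 ≤ ‖(2 * j + 1 - 2 * m : ℂ)‖ := by
  have h : (2 * j + 1 - 2 * m : ℂ) = ((2 * j + 1 - 2 * m : ℤ) : ℂ) := by push_cast; ring
  rw [h, Complex.norm_intCast]
  exact_mod_cast Int.one_le_abs (by omega)

theorem odd_ne_zero (j : ℕ) (m : ℤ) : (2 * j + 1 - 2 * m : ℂ) ≠ 0 :=
  norm_pos_iff.1 (zero_lt_one.trans_le (one_le_norm_odd j m))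

/-- The odd factor of the denominator has norm at least `1`, so the factor `2j + 2` alone supplies
the factorial. -/
theorem norm_evenCoeff_le (c : ℂ) (m : ℤ) (j : ℕ) :
    ‖evenCoeff c m j‖ ≤ 1 * ((‖c‖ ^ 2) ^ j / j.factorial) := by
  induction j with
  | zero => simp [evenCoeff]
  | succ j ih =>
    have h2 : ‖(2 * j + 2 : ℂ)‖ = 2 * j + 2 := by
      have : (2 * j + 2 : ℂ) = ((2 * j + 2 : ℕ) : ℂ) := by push_cast; ring
      rw [this, Complex.norm_natCast]; push_cast; ring
    have h1 := one_le_norm_odd j m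
    have hden : ((j : ℝ) + 1) ≤ ‖(2 * j + 2 : ℂ) * (2 * j + 1 - 2 * m)‖ := by
      rw [norm_mul, h2]
      nlinarith [(Nat.cast_nonneg j : (0 : ℝ) ≤ j)]
    rw [evenCoeff, norm_mul, norm_div, norm_pow]
    calc ‖c‖ ^ 2 / ‖(2 * j + 2 : ℂ) * (2 * j + 1 - 2 * m)‖ * ‖evenCoeff c m j‖
        ≤ ‖c‖ ^ 2 / (j + 1) * (1 * ((‖c‖ ^ 2) ^ j / j.factorial)) := by gcongr
      _ = _ := by
        rw [Nat.factorial_succ]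
        push_cast
        field_simp
        ring

theorem norm_oddCoeff_le (c : ℂ) (m : ℤ) (j : ℕ) :
    ‖oddCoeff c m j‖ ≤ ‖c‖ * ((‖c‖ ^ 2) ^ j / j.factorial) := by
  rw [oddCoeff, norm_mul, norm_div, norm_neg]
  calc _ ≤ ‖c‖ / 1 * (1 * ((‖c‖ ^ 2) ^ j / j.factorial)) := by
        gcongr
        · exact one_le_norm_odd j m
        · exact norm_evenCoeff_le c m j
    _ = _ := by ring

/-- The series of the even component, in the variable `y = z ^ 2`. -/
noncomputable def evenSeries (c : ℂ) (m : ℤ) (y : ℂ) : ℂ := ∑' j, evenCoeff c m j * y ^ j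

/-- The series of the odd component divided by `z`, in the variable `y = z ^ 2`. -/
noncomputable def oddSeries (c : ℂ) (m : ℤ) (y : ℂ) : ℂ := ∑' j, oddCoeff c m j * y ^ j

theorem evenSeries_zero (c : ℂ) (m : ℤ) : evenSeries c m 0 = 1 := by
  rw [evenSeries, tsum_eq_single 0 fun j hj => by simp [hj]]
  simp [evenCoeff]

theorem hasDerivAt_evenSeries (c : ℂ) (m : ℤ) (y : ℂ) :
    HasDerivAt (evenSeries c m) (-c / 2 * oddSeries c m y) y := by
  refine HasDerivAt.congr_deriv ((hasDerivAt_tsum_of_norm_le_div_factorial (norm_evenCoeff_le c m) y).1) ?_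
  rw [oddSeries, ← tsum_mul_left]
  refine tsum_congr fun j => ?_
  have h1 := odd_ne_zero j m
  have h2 : (j + 1 : ℂ) ≠ 0 := Nat.cast_add_one_ne_zero j
  have h3 : (2 * j + 2 : ℂ) = 2 * (j + 1) := by ring
  rw [evenCoeff, oddCoeff, h3]
  field_simp

/-- The equation is singular at `y = 0`, so it is stated for `y * d` and not solved for `d`. -/
theorem exists_hasDerivAt_oddSeries (c : ℂ) (m : ℤ) (y : ℂ) :
    ∃ d, HasDerivAt (oddSeries c m) d y ∧
      2 * (y * d) = (2 * m - 1) * oddSeries c m y - c * evenSeries c m y := by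
  obtain ⟨hd, hs, hs'⟩ := hasDerivAt_tsum_of_norm_le_div_factorial (norm_oddCoeff_le c m) y
  obtain ⟨-, he, -⟩ := hasDerivAt_tsum_of_norm_le_div_factorial (norm_evenCoeff_le c m) y
  refine ⟨_, hd, ?_⟩
  have hshift : y * ∑' j : ℕ, (j + 1 : ℂ) * oddCoeff c m (j + 1) * y ^ j =
      ∑' j : ℕ, (j : ℂ) * oddCoeff c m j * y ^ j := by
    have hs'' : Summable fun j : ℕ => (j : ℂ) * oddCoeff c m j * y ^ j := by
      rw [← summable_nat_add_iff 1]
      refine (hs'.mul_left y).congr fun j => ?_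
      push_cast
      ring
    rw [hs''.tsum_eq_zero_add, ← tsum_mul_left]
    simp only [Nat.cast_zero, zero_mul, zero_add]
    refine tsum_congr fun j => ?_
    push_cast
    ring
  rw [hshift, oddSeries, evenSeries, ← tsum_mul_left, ← tsum_mul_left, ← tsum_mul_left,
    ← (hs.mul_left _).tsum_sub (he.mul_left _)]
  refine tsum_congr fun j => ?_
  have h1 := odd_ne_zero j m
  rw [oddCoeff]
  field_simp
  ring

/-- The Wronskian of the two Frobenius solutions. -/
theorem wronskian_series (c : ℂ) (m : ℤ) (y : ℂ) :
    evenSeries c m y * evenSeries c (-m) y - y * (oddSeries c m y * oddSeries c (-m) y) = 1 := by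
  have hd : ∀ y, HasDerivAt (fun y => evenSeries c m y * evenSeries c (-m) y -
      y * (oddSeries c m y * oddSeries c (-m) y)) 0 y := fun y => by
    obtain ⟨d, hd, h⟩ := exists_hasDerivAt_oddSeries c m y
    obtain ⟨d', hd', h'⟩ := exists_hasDerivAt_oddSeries c (-m) y
    refine HasDerivAt.congr_deriv (((hasDerivAt_evenSeries c m y).mul (hasDerivAt_evenSeries c (-m) y)).sub
      ((hasDerivAt_id y).mul (hd.mul hd'))) ?_
    push_cast at h'
    simp only [id]
    -- The factor `y` in front of the odd product lets the singular equations eliminate both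
    -- derivatives.
    linear_combination -(oddSeries c (-m) y * h + oddSeries c m y * h') / 2
  have := is_const_of_deriv_eq_zero (fun y => (hd y).differentiableAt)
    (fun y => (hd y).deriv) y 0
  simpa [evenSeries_zero] using this

/-! ### The Frobenius solutions along the loop -/

/-- The phase `z(t) = e^{i (ω t + θ)}` of the loop. -/
noncomputable def phase (ω θ t : ℝ) : ℂ := Complex.exp (Complex.I * ((ω * t + θ : ℝ) : ℂ))

theorem phase_ne_zero (ω θ t : ℝ) : phase ω θ t ≠ 0 := Complex.exp_ne_zero _

theorem hasDerivAt_phase (ω θ t : ℝ) :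
    HasDerivAt (phase ω θ) (Complex.I * ω * phase ω θ t) t := by
  have h : HasDerivAt (fun t : ℝ => ω * t + θ) ω t := by
    simpa using ((hasDerivAt_id t).const_mul ω).add_const θ
  refine HasDerivAt.congr_deriv ((h.ofReal_comp.const_mul Complex.I).cexp) ?_
  rw [phase]
  ring

theorem phase_add_period {ω : ℝ} (hω : ω ≠ 0) (θ t : ℝ) :
    phase ω θ (t + 2 * Real.pi / ω) = phase ω θ t := by
  have h : Complex.I * ((ω * (t + 2 * Real.pi / ω) + θ : ℝ) : ℂ) =
      Complex.I * ((ω * t + θ : ℝ) : ℂ) + 2 * Real.pi * Complex.I := by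
    have : ω * (t + 2 * Real.pi / ω) + θ = ω * t + θ + 2 * Real.pi := by field_simp; ring
    rw [this]
    push_cast
    ring
  rw [phase, h, Complex.exp_add, Complex.exp_two_pi_mul_I, mul_one, phase]

/-- The even Frobenius component `z ^ (-m) F(z ^ 2)` along the loop. -/
noncomputable def evenPart (c : ℂ) (m : ℤ) (ω θ t : ℝ) : ℂ :=
  phase ω θ t ^ (-m) * evenSeries c m (phase ω θ t ^ 2)

/-- The odd Frobenius component `z ^ (-m) z G(z ^ 2)` along the loop. -/
noncomputable def oddPart (c : ℂ) (m : ℤ) (ω θ t : ℝ) : ℂ :=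
  phase ω θ t ^ (-m) * (phase ω θ t * oddSeries c m (phase ω θ t ^ 2))

theorem hasDerivAt_phase_zpow (m : ℤ) (ω θ t : ℝ) :
    HasDerivAt (fun t => phase ω θ t ^ m) (Complex.I * ω * m * phase ω θ t ^ m) t := by
  have hz := phase_ne_zero ω θ t
  refine HasDerivAt.congr_deriv ((hasDerivAt_zpow m (phase ω θ t) (Or.inl hz)).comp_of_eq t
    (hasDerivAt_phase ω θ t) rfl) ?_
  rw [zpow_sub_one₀ hz]
  field_simp

theorem hasDerivAt_phase_sq (ω θ t : ℝ) :
    HasDerivAt (fun t => phase ω θ t ^ 2) (2 * Complex.I * ω * phase ω θ t ^ 2) t := by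
  refine HasDerivAt.congr_deriv ((hasDerivAt_phase ω θ t).pow 2) ?_
  push_cast
  ring

theorem hasDerivAt_evenPart (c : ℂ) (m : ℤ) (ω θ t : ℝ) :
    HasDerivAt (evenPart c m ω θ) (-Complex.I * ω *
      (m * evenPart c m ω θ t + c * phase ω θ t * oddPart c m ω θ t)) t := by
  refine HasDerivAt.congr_deriv ((hasDerivAt_phase_zpow (-m) ω θ t).mul ((hasDerivAt_evenSeries c m _).comp_of_eq t
    (hasDerivAt_phase_sq ω θ t) rfl)) ?_
  simp only [evenPart, oddPart]
  push_cast
  ring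

theorem hasDerivAt_oddPart (c : ℂ) (m : ℤ) (ω θ t : ℝ) :
    HasDerivAt (oddPart c m ω θ) (-Complex.I * ω *
      (-m * oddPart c m ω θ t + c * phase ω θ t * evenPart c m ω θ t)) t := by
  obtain ⟨d, hd, h⟩ := exists_hasDerivAt_oddSeries c m (phase ω θ t ^ 2)
  refine HasDerivAt.congr_deriv ((hasDerivAt_phase_zpow (-m) ω θ t).mul ((hasDerivAt_phase ω θ t).mul
    (hd.comp_of_eq t (hasDerivAt_phase_sq ω θ t) rfl))) ?_
  simp only [evenPart, oddPart]
  push_cast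
  linear_combination (phase ω θ t ^ (-m) * Complex.I * ω * phase ω θ t) * h

theorem wronskian_parts (c : ℂ) (m : ℤ) (ω θ t : ℝ) :
    evenPart c m ω θ t * evenPart c (-m) ω θ t -
      oddPart c m ω θ t * oddPart c (-m) ω θ t = 1 := by
  have hz : phase ω θ t ^ (-m) * phase ω θ t ^ (- -m) = 1 := by
    rw [← zpow_add₀ (phase_ne_zero ω θ t), add_neg_cancel, zpow_zero]
  have h := wronskian_series c m (phase ω θ t ^ 2)
  simp only [evenPart, oddPart]
  linear_combination h * phase ω θ t ^ (-m) * phase ω θ t ^ (- -m) + hz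

end LoopB

/-! ### Evolution, Wronskian and transfer matrix -/

theorem mulVec_loopBHamiltonian (κ ρ ω θ t : ℝ) (v : Fin 2 → ℂ) :
    loopBHamiltonian κ ρ ω θ t *ᵥ v =
      ![loopB ρ ω θ t * v 0 + κ * v 1, κ * v 0 - loopB ρ ω θ t * v 1] := by
  ext i
  fin_cases i
  · simp [loopBHamiltonian, pauliX, pauliZ, Matrix.mulVec, dotProduct, Fin.sum_univ_two]
  · simp [loopBHamiltonian, pauliX, pauliZ, Matrix.mulVec, dotProduct, Fin.sum_univ_two]
    ring

theorem isEvolution_loopBHamiltonian_iff {κ ρ ω θ : ℝ} {ψ : ℝ → Fin 2 → ℂ} :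
    IsEvolution (loopBHamiltonian κ ρ ω θ) ψ ↔ ∀ t,
      HasDerivAt (fun t => ψ t 0) (-Complex.I * (loopB ρ ω θ t * ψ t 0 + κ * ψ t 1)) t ∧
      HasDerivAt (fun t => ψ t 1) (-Complex.I * (κ * ψ t 0 - loopB ρ ω θ t * ψ t 1)) t := by
  refine forall_congr' fun t => ?_
  rw [hasDerivAt_pi, Fin.forall_fin_two, mulVec_loopBHamiltonian]
  simp

/-- In the basis `u = a + b`, `v = a - b` the evolution equation reads
`i u' = κ u + h v`, `i v' = -κ v + h u`. -/
theorem isEvolution_of_sum_sub {κ ρ ω θ : ℝ} {u v : ℝ → ℂ}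
    (hu : ∀ t, HasDerivAt u (-Complex.I * (κ * u t + loopB ρ ω θ t * v t)) t)
    (hv : ∀ t, HasDerivAt v (-Complex.I * (-κ * v t + loopB ρ ω θ t * u t)) t) :
    IsEvolution (loopBHamiltonian κ ρ ω θ) fun t => ![(u t + v t) / 2, (u t - v t) / 2] := by
  rw [isEvolution_loopBHamiltonian_iff]
  refine fun t => ⟨?_, ?_⟩
  · refine HasDerivAt.congr_deriv (((hu t).add (hv t)).div_const 2) ?_
    simp only [Matrix.cons_val_zero, Matrix.cons_val_one]
    ring
  · refine HasDerivAt.congr_deriv (((hu t).sub (hv t)).div_const 2) ?_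
    simp only [Matrix.cons_val_zero, Matrix.cons_val_one]
    ring

/-- The Wronskian of two solutions does not depend on the time. -/
theorem wronskian_eq_of_isEvolution {κ ρ ω θ : ℝ} {ψ φ : ℝ → Fin 2 → ℂ}
    (hψ : IsEvolution (loopBHamiltonian κ ρ ω θ) ψ)
    (hφ : IsEvolution (loopBHamiltonian κ ρ ω θ) φ) (s t : ℝ) :
    ψ s 0 * φ s 1 - ψ s 1 * φ s 0 = ψ t 0 * φ t 1 - ψ t 1 * φ t 0 := by
  rw [isEvolution_loopBHamiltonian_iff] at hψ hφ
  have hd : ∀ t, HasDerivAt (fun t => ψ t 0 * φ t 1 - ψ t 1 * φ t 0) 0 t := fun t => by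
    -- The Hamiltonian has trace zero, so the derivative vanishes.
    refine HasDerivAt.congr_deriv (((hψ t).1.mul (hφ t).2).sub ((hψ t).2.mul (hφ t).1)) ?_
    ring
  exact is_const_of_deriv_eq_zero (fun t => (hd t).differentiableAt) (fun t => (hd t).deriv) s t

theorem IsEvolution.smul_add_smul {H : ℝ → Matrix (Fin 2) (Fin 2) ℂ} {ψ φ : ℝ → Fin 2 → ℂ}
    (hψ : IsEvolution H ψ) (hφ : IsEvolution H φ) (x y : ℂ) :
    IsEvolution H fun t => x • ψ t + y • φ t := fun t => by
  refine HasDerivAt.congr_deriv (((hψ t).const_smul x).add ((hφ t).const_smul y)) ?_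
  rw [Matrix.mulVec_add, Matrix.mulVec_smul, Matrix.mulVec_smul, smul_add, smul_comm x,
    smul_comm y]

/-- Two independent solutions taking the same values at `t₀` and `t₁` make the transfer matrix
from `t₀` to `t₁` the identity. -/
theorem isTransferMatrix_one_of_fundamental {κ ρ ω θ t₀ t₁ : ℝ} {φ φ' : ℝ → Fin 2 → ℂ}
    (hφ : IsEvolution (loopBHamiltonian κ ρ ω θ) φ)
    (hφ' : IsEvolution (loopBHamiltonian κ ρ ω θ) φ')
    (hp : φ t₁ = φ t₀) (hp' : φ' t₁ = φ' t₀)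
    (hW : φ t₀ 0 * φ' t₀ 1 - φ t₀ 1 * φ' t₀ 0 ≠ 0) :
    IsTransferMatrix (loopBHamiltonian κ ρ ω θ) t₁ t₀ 1 := by
  refine ⟨fun v => ?_, fun ψ hψ => ?_⟩
  · set W := φ t₀ 0 * φ' t₀ 1 - φ t₀ 1 * φ' t₀ 0 with hWdef
    -- Cramer's rule gives the coefficients.
    refine ⟨_, hφ.smul_add_smul hφ' ((v 0 * φ' t₀ 1 - v 1 * φ' t₀ 0) / W)
      ((φ t₀ 0 * v 1 - φ t₀ 1 * v 0) / W), ?_⟩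
    ext i
    fin_cases i <;>
    · simp only [Fin.zero_eta, Fin.mk_one, Pi.add_apply, Pi.smul_apply, smul_eq_mul]
      field_simp
      rw [hWdef]
      ring
  -- `ψ t₁ - ψ t₀` has zero Wronskian with two independent vectors, hence vanishes; this replaces a
  -- uniqueness theorem for the equation.
  · have h := wronskian_eq_of_isEvolution hψ hφ t₁ t₀
    have h' := wronskian_eq_of_isEvolution hψ hφ' t₁ t₀
    rw [hp] at h
    rw [hp'] at h'
    rw [Matrix.one_mulVec]
    ext i
    fin_cases i
    · refine mul_right_cancel₀ hW ?_
      simp only [Fin.zero_eta]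
      linear_combination φ t₀ 0 * h' - φ' t₀ 0 * h
    · refine mul_right_cancel₀ hW ?_
      simp only [Fin.mk_one]
      linear_combination φ t₀ 1 * h' - φ' t₀ 1 * h

open LoopB in
theorem isTransferMatrix_loopB_one (κ ρ : ℝ) {ω : ℝ} (hω : ω ≠ 0) {n : ℤ}
    (hn : κ / ω = (n : ℝ)) (θ : ℝ) {t₀ t₁ : ℝ} (hper : phase ω θ t₁ = phase ω θ t₀) :
    IsTransferMatrix (loopBHamiltonian κ ρ ω θ) t₁ t₀ 1 := by
  have hω' : (ω : ℂ) ≠ 0 := by exact_mod_cast hω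
  have hκ : (κ : ℂ) = ω * n := by
    rw [div_eq_iff hω] at hn
    rw [hn]
    push_cast
    ring
  obtain ⟨c, hc⟩ : ∃ c : ℂ, ω * c = -Complex.I * ρ := ⟨_, mul_div_cancel₀ _ hω'⟩
  have hB : ∀ t, loopB ρ ω θ t = ω * c * phase ω θ t := fun t => by rw [hc]; rfl
  refine isTransferMatrix_one_of_fundamental
    (φ := fun t => ![(evenPart c n ω θ t + oddPart c n ω θ t) / 2,
      (evenPart c n ω θ t - oddPart c n ω θ t) / 2])
    -- Swapping `u` and `v` changes the sign of `κ`, hence the index `-n`.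
    (φ' := fun t => ![(oddPart c (-n) ω θ t + evenPart c (-n) ω θ t) / 2,
      (oddPart c (-n) ω θ t - evenPart c (-n) ω θ t) / 2])
    (isEvolution_of_sum_sub (fun t => ?_) fun t => ?_)
    (isEvolution_of_sum_sub (fun t => ?_) fun t => ?_) ?_ ?_ ?_
  · refine HasDerivAt.congr_deriv (hasDerivAt_evenPart c n ω θ t) ?_
    rw [hκ, hB]
    ring
  · refine HasDerivAt.congr_deriv (hasDerivAt_oddPart c n ω θ t) ?_
    rw [hκ, hB]
    ring
  · refine HasDerivAt.congr_deriv (hasDerivAt_oddPart c (-n) ω θ t) ?_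
    rw [hκ, hB]
    push_cast
    ring
  · refine HasDerivAt.congr_deriv (hasDerivAt_evenPart c (-n) ω θ t) ?_
    rw [hκ, hB]
    push_cast
    ring
  · simp only [evenPart, oddPart, hper]
  · simp only [evenPart, oddPart, hper]
  · have h := wronskian_parts c n ω θ t₀
    simp only [Matrix.cons_val_zero, Matrix.cons_val_one]
    intro h0
    -- Passing from `(u, v)` to `(a, b)` multiplies the Wronskian by `-1/2`.
    have : (1 : ℂ) = 0 := by linear_combination -2 * h0 - h
    exact one_ne_zero this

/-! ### Overlaps and the conclusion -/

theorem normalizedOverlap_self (R : Module.Basis (Fin 2) ℂ (Fin 2 → ℂ)) {ψ : Fin 2 → ℂ}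
    (hψ : ψ ≠ 0) : normalizedOverlap R ψ ψ = 1 := by
  have hpos : 0 < ‖R.repr ψ 0‖ ^ 2 + ‖R.repr ψ 1‖ ^ 2 := by
    by_contra! h
    have h0 : R.repr ψ 0 = 0 := norm_eq_zero.1 <| by
      nlinarith [sq_nonneg (‖R.repr ψ 0‖), sq_nonneg (‖R.repr ψ 1‖)]
    have h1 : R.repr ψ 1 = 0 := norm_eq_zero.1 <| by
      nlinarith [sq_nonneg (‖R.repr ψ 0‖), sq_nonneg (‖R.repr ψ 1‖)]
    refine hψ (R.repr.map_eq_zero_iff.1 ?_)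
    ext i
    fin_cases i
    · exact h0
    · exact h1
  have hnum : star (R.repr ψ 0) * R.repr ψ 0 + star (R.repr ψ 1) * R.repr ψ 1 =
      ((‖R.repr ψ 0‖ ^ 2 + ‖R.repr ψ 1‖ ^ 2 : ℝ) : ℂ) := by
    have h : ∀ z : ℂ, star z * z = (‖z‖ : ℂ) ^ 2 := fun z => Complex.conj_mul' z
    rw [h, h]
    push_cast
    ring
  rw [normalizedOverlap, hnum, Complex.norm_real, Real.norm_of_nonneg hpos.le, sq,
    div_self (mul_pos hpos hpos).ne']

open LoopB in
theorem mainTheorem4 (κ ρ ω : ℝ) (hω : 0 < ω) (n : ℤ) (hn : κ / ω = (n : ℝ)) :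
    (∀ θ t₀ : ℝ,
      IsTransferMatrix (loopBHamiltonian κ ρ ω θ) (t₀ + 2 * Real.pi / ω) t₀ 1 ∧
      IsTransferMatrix (loopBHamiltonian κ ρ (-ω) θ) (t₀ + 2 * Real.pi / ω) t₀ 1 ∧
      transferMatrix (loopBHamiltonian κ ρ ω θ) (t₀ + 2 * Real.pi / ω) t₀ = 1 ∧
      transferMatrix (loopBHamiltonian κ ρ (-ω) θ) (t₀ + 2 * Real.pi / ω) t₀ = 1) ∧
    ∀ (θ : ℝ) (R : Module.Basis (Fin 2) ℂ (Fin 2 → ℂ)),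
      IsAdiabaticBasis (loopBHamiltonian κ ρ ω θ 0) R →
        nonChiralityDegree κ ρ ω θ R = 1 := by
  have hplus : ∀ θ t₀ : ℝ,
      IsTransferMatrix (loopBHamiltonian κ ρ ω θ) (t₀ + 2 * Real.pi / ω) t₀ 1 := fun θ t₀ =>
    isTransferMatrix_loopB_one κ ρ hω.ne' hn θ (phase_add_period hω.ne' θ t₀)
  have hminus : ∀ θ t₀ : ℝ,
      IsTransferMatrix (loopBHamiltonian κ ρ (-ω) θ) (t₀ + 2 * Real.pi / ω) t₀ 1 :=
    fun θ t₀ => by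
      refine isTransferMatrix_loopB_one κ ρ (neg_ne_zero.2 hω.ne') (n := -n)
        (by rw [div_neg, hn]; push_cast; ring) θ ?_
      -- With `-ω` the period formula gives the shift `-2π/ω`, which leads from `t₀ + 2π/ω` back to
      -- `t₀`.
      rw [← phase_add_period (neg_ne_zero.2 hω.ne') θ (t₀ + 2 * Real.pi / ω)]
      congr 1
      rw [div_neg]
      ring
  refine ⟨fun θ t₀ => ⟨hplus θ t₀, hminus θ t₀, (hplus θ t₀).transferMatrix_eq,
    (hminus θ t₀).transferMatrix_eq⟩, fun θ R _ => ?_⟩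
  have h1 := (hplus θ 0).transferMatrix_eq
  have h2 := (hminus θ 0).transferMatrix_eq
  rw [zero_add] at h1 h2
  have h : ∀ α, nonChiralityOf κ ρ ω θ R α = 1 := fun α => by
    rw [nonChiralityOf, h1, h2, Matrix.one_mulVec, normalizedOverlap_self R (R.ne_zero α)]
  rw [nonChiralityDegree, h, h]
  norm_num
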